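/- Let $S=\{0,h,1\}$ be the three-element Boolean semiring: multiplication is the meet of the chain $0<h<1$, and addition is commutative with $0+x=x$, $1+1=h$, $h+h=h$, $h+1=1$; the lattice operations of the chain are $x\wedge y=xy$ and $x\vee y=x+y+xy$. Put $r_1=S^2\setminus\{(1,0)\}$, $r_2=S^2\setminus\{(h,0),(1,0)\}$, $r_3=S^2\setminus\{(0,1),(h,1),(1,0),(1,h)\}$, and let $\lambda_1$ be the binary partial operation on $S$ with domain $r_1$ given by $$\lambda_1(0,0)=\lambda_1(h,0)=0,\quad \lambda_1(h,h)=\lambda_1(0,h)=\lambda_1(0,1)=\lambda_1(h,1)=h,\quad \lambda_1(1,1)=\lambda_1(1,h)=1 .$$ With the discrete topology $\mathcal T$ on $S$ consider the structured topological spaces $\mathbf S=\langle S;\{r_1,r_2,r_3\},\mathcal T\rangle$ and $\mathbf S_{os}=\langle S;\{r_2\},\{\lambda_1\},\mathcal T\rangle$. For such a space $\mathbf X$ let $IS_cP^+(\mathbf X)$ be the category of isomorphic copies of topologically closed substructures of non-empty powers of $\mathbf X$, whose morphisms are all continuous maps preserving the relations and the (partial) operations; put $\chi=IS_cP^+(\mathbf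 S)$ and $\chi_{os}=IS_cP^+(\mathbf S_{os})$. The set $\chi_{os}(\mathbf S_{os}^n,\mathbf S_{os})$ of morphisms is a sublattice of $S^{S^n}$ with the pointwise order; an element of it is join-irreducible if it is not the least element and is not the join of two elements different from it. Call a poset $P$ with a subset $Y$ (the base; the elements of $P\setminus Y$ are the hairs) an $n$-dimensional hairy cube if $Y$ is order-isomorphic to $\{0,1\}^n$, the hairs are pairwise incomparable, each element of $Y$ is covered in $P$ by exactly one hair, and each hair covers in $P$ exactly one element of $Y$. Then for every $n\in\mathbb N$: $\mathbf S_{os}^n$ is an object of $\chi_{os}$ and $\mathbf S^n$ is an object of $\chi$; $$\chi_{os}(\mathbf S_{os}^n,\mathbf S_{os})=\chi(\mathbf S^n,\mathbf S)$$ as sets of maps $S^n\to S$, and this set is the set of $n$-ary term functions of the semiring $S$ (language $0,1,+,\cdot$); and the poset $P$ of join-irreducible elements of $\chi_{os}(\mathbf S_{os}^n,\mathbf S_{os})$, with the pointwise order and the base $Y=\{\Phi\in P\mid \Phi(x)\le h\text{ for all }x\}$, is an $n$-dimensional hairy cube. -/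

import Mathlib

namespace HairyCube

/-! ### The three-element Boolean semiring -/

/-- The carrier `{0, h, 1}`. -/
inductive S : Type
  | zero
  | h
  | one
  deriving DecidableEq

namespace S

instance : Fintype S := ⟨{zero, h, one}, by intro x; cases x <;> simp⟩

/-- Addition: `0` is neutral, `1 + 1 = h`, `h + h = h`, `h + 1 = 1`. -/
def add : S → S → S
  | zero, y => y
  | x, zero => x
  | h, h => h
  | h, one => one
  | one, h => one
  | one, one => h

/-- Multiplication: `0` is absorbing, `1` is neutral, `h * h = h`. -/
def mul : S → S → S
  | zero, _ => zero
  | _, zero => zero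
  | h, _ => h
  | one, y => y

instance : Zero S := ⟨zero⟩
instance : One S := ⟨one⟩
instance : Add S := ⟨add⟩
instance : Mul S := ⟨mul⟩

/-- The semiring on `{0, h, 1}`: it is the subsemiring `{(0,0), (1,0), (1,1)}` of the product of the
two-element lattice (addition is the join) and the two-element field, with `h = 1 + 1 = (1,0)`. -/
instance : CommSemiring S where
  add_assoc := by decide
  zero_add := by decide
  add_zero := by decide
  add_comm := by decide
  mul_assoc := by decide
  mul_comm := by decide
  one_mul := by decide
  mul_one := by decide
  left_distrib := by decide
  right_distrib := by decide
  zero_mul := by decide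
  mul_zero := by decide
  nsmul := nsmulRec

/-- The lattice order of a Boolean semiring: `x ≤ y` iff `x * y = x`, `x ⊓ y = x * y` and
`x ⊔ y = x + y + x * y`. Here it is the chain `0 < h < 1`. -/
instance : Lattice S where
  le x y := x * y = x
  le_refl := by decide
  le_trans := by decide
  le_antisymm := by decide
  sup x y := x + y + x * y
  le_sup_left := by decide
  le_sup_right := by decide
  sup_le := by decide
  inf x y := x * y
  inf_le_left := by decide
  inf_le_right := by decide
  le_inf := by decide

instance : DecidableLE S := fun x y => inferInstanceAs (Decidable (x * y = x))

theorem zero_lt_h_lt_one : (0 : S) < h ∧ h < (1 : S) := by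
  simp only [lt_iff_le_not_ge]; decide

instance : TopologicalSpace S := ⊥
instance : DiscreteTopology S := ⟨rfl⟩

end S

/-- Terms in `n` variables in the language `0, 1, +, *` of semirings. -/
inductive SemiringTerm (n : ℕ) : Type
  | var (i : Fin n)
  | zero
  | one
  | add (s t : SemiringTerm n)
  | mul (s t : SemiringTerm n)

/-- The value of a term in the semiring `S` at a point of `S ^ n`. -/
def SemiringTerm.eval {n : ℕ} (x : Fin n → S) : SemiringTerm n → S
  | .var i => x i
  | .zero => 0
  | .one => 1
  | .add s t => s.eval x + t.eval x
  | .mul s t => s.eval x * t.eval x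

/-- The set of `n`-ary term functions of the semiring `S`. -/
def termFunctions (n : ℕ) : Set ((Fin n → S) → S) :=
  {f | ∃ t : SemiringTerm n, ∀ x, f x = t.eval x}

/-! ### Structured topological spaces -/

/-- A type of structured topological spaces: symbols, with arities, for total operations, partial
operations and relations. -/
structure Signature where
  Op : Type
  opArity : Op → ℕ
  POp : Type
  popArity : POp → ℕ
  Rel : Type
  relArity : Rel → ℕ

/-- A structured topological space `⟨X; G, H, R, 𝒯⟩`. -/
structure StructuredSpace (L : Signature) where
  carrier : Type
  top : TopologicalSpace carrier
  op : ∀ g : L.Op, (Fin (L.opArity g) → carrier) → carrier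
  pop : ∀ p : L.POp, (Fin (L.popArity p) → carrier) →. carrier
  rel : ∀ r : L.Rel, Set (Fin (L.relArity r) → carrier)

instance {L : Signature} (X : StructuredSpace L) : TopologicalSpace X.carrier := X.top

namespace StructuredSpace

variable {L : Signature}

/-- The power `X ^ I`: product topology, everything pointwise. A partial operation is defined at a
tuple iff it is defined in every coordinate. -/
def power (X : StructuredSpace L) (I : Type) : StructuredSpace L where
  carrier := I → X.carrier
  top := inferInstance
  op g x := fun i => X.op g (fun k => x k i)
  pop p x := ⟨∀ i, (X.pop p (fun k => x k i)).Dom, fun hx i => (X.pop p (fun k => x k i)).get (hx i)⟩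
  rel r := {x | ∀ i, (fun k => x k i) ∈ X.rel r}

/-- Morphisms: continuous maps preserving operations, partial operations and relations (in
particular, they map the domain of each partial operation into the corresponding domain). -/
structure IsMorphism (X Y : StructuredSpace L) (f : X.carrier → Y.carrier) : Prop where
  continuous : Continuous f
  map_op : ∀ g x, f (X.op g x) = Y.op g (f ∘ x)
  map_pop : ∀ p x, ∀ y ∈ X.pop p x, f y ∈ Y.pop p (f ∘ x)
  map_rel : ∀ r, ∀ x ∈ X.rel r, f ∘ x ∈ Y.rel r

/-- `f` is an isomorphism of `X` onto a topologically closed substructure of `Y`. The condition on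
partial operations says that `y` is a value at `f ∘ x` iff it is the image of a value at `x`; so the
range of `f` is closed under the partial operations of `Y` and `f` reflects their domains. -/
structure IsClosedEmbedding (X Y : StructuredSpace L) (f : X.carrier → Y.carrier) : Prop where
  isClosedEmbedding : Topology.IsClosedEmbedding f
  map_op : ∀ g x, f (X.op g x) = Y.op g (f ∘ x)
  map_pop : ∀ p x, Y.pop p (f ∘ x) = (X.pop p x).map f
  map_rel : ∀ r x, x ∈ X.rel r ↔ f ∘ x ∈ Y.rel r

/-- The class `IS_cP⁺(M)` of isomorphic copies of closed substructures of non-empty powers of `M`.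
As a category it has all morphisms between its objects. -/
def IScP (M : StructuredSpace L) : Set (StructuredSpace L) :=
  {X | ∃ I : Type, Nonempty I ∧ ∃ f, IsClosedEmbedding X (M.power I) f}

/-- The set of morphisms from `X` to `Y`. -/
def homSet (X Y : StructuredSpace L) : Set (X.carrier → Y.carrier) :=
  {f | IsMorphism X Y f}

end StructuredSpace

open StructuredSpace

/-! ### The two structures on `{0, h, 1}` -/

/-- `S² ∖ {(1,0)}` -/
def r₁ : Set (S × S) := {(1, 0)}ᶜ

/-- `S² ∖ {(h,0), (1,0)}` -/
def r₂ : Set (S × S) := {(S.h, 0), (1, 0)}ᶜ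

/-- `S² ∖ {(0,1), (h,1), (1,0), (1,h)}` -/
def r₃ : Set (S × S) := {(0, 1), (S.h, 1), (1, 0), (1, S.h)}ᶜ

instance : DecidablePred (· ∈ r₁) := fun x => inferInstanceAs (Decidable (¬ x = (1, 0)))

instance : DecidablePred (· ∈ r₂) := fun x =>
  inferInstanceAs (Decidable (¬ (x = (S.h, 0) ∨ x = (1, 0))))

/-- The values of the partial operation `λ₁`; the value at `(1,0)`, which is outside the domain
`r₁`, is irrelevant. -/
def lambdaVal : S → S → S
  | .zero, .zero => .zero
  | .h, .h => .h
  | .one, .one => .one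
  | .zero, .h => .h
  | .zero, .one => .h
  | .h, .zero => .zero
  | .h, .one => .h
  | .one, .h => .one
  | .one, .zero => .zero

/-- The binary partial operation `λ₁` with domain `r₁`. -/
def lambda₁ : S × S →. S := fun x => ⟨x ∈ r₁, fun _ => lambdaVal x.1 x.2⟩

/-- Three binary relation symbols. -/
def sigThreeRel : Signature where
  Op := Empty
  opArity := Empty.elim
  POp := Empty
  popArity := Empty.elim
  Rel := Fin 3
  relArity _ := 2

/-- The structure `⟨S; {r₁, r₂, r₃}, 𝒯⟩` with the discrete topology. -/
def SStruct : StructuredSpace sigThreeRel where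
  carrier := S
  top := inferInstance
  op g := g.elim
  pop p := p.elim
  rel r := {x : Fin 2 → S | (x 0, x 1) ∈ (![r₁, r₂, r₃] : Fin 3 → Set (S × S)) r}

/-- One binary partial operation symbol and one binary relation symbol. -/
def sigOs : Signature where
  Op := Empty
  opArity := Empty.elim
  POp := Unit
  popArity _ := 2
  Rel := Unit
  relArity _ := 2

/-- The structure `S_os = ⟨S; {r₂}, {λ₁}, 𝒯⟩` with the discrete topology. -/
def SOs : StructuredSpace sigOs where
  carrier := S
  top := inferInstance
  op g := g.elim
  pop _ := fun x : Fin 2 → S => lambda₁ (x 0, x 1)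
  rel _ := {x : Fin 2 → S | (x 0, x 1) ∈ r₂}

/-! ### The lattice of morphisms into `S_os` -/

theorem mem_lambda₁ (a b c : S) : c ∈ lambda₁ (a, b) ↔ (a, b) ∈ r₁ ∧ lambdaVal a b = c := by
  simp [lambda₁, Part.mem_mk_iff]

/-- A binary operation on `S` that preserves `r₂` and `λ₁` acts pointwise on morphisms. -/
theorem isMorphism_pointwise (m : S → S → S)
    (h₂ : ∀ a b c d, (a, b) ∈ r₂ → (c, d) ∈ r₂ → (m a c, m b d) ∈ r₂)
    (h₁ : ∀ a b c d, (a, b) ∈ r₁ → (c, d) ∈ r₁ → (m a c, m b d) ∈ r₁ ∧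
      lambdaVal (m a c) (m b d) = m (lambdaVal a b) (lambdaVal c d))
    (X : StructuredSpace sigOs) (f g : X.carrier → S)
    (hf : IsMorphism X SOs f) (hg : IsMorphism X SOs g) :
    IsMorphism X SOs (fun x => m (f x) (g x)) where
  continuous := by
    have hf' : Continuous f := hf.continuous
    have hg' : Continuous g := hg.continuous
    have hm : Continuous (fun p : S × S => m p.1 p.2) := continuous_of_discreteTopology
    exact hm.comp (hf'.prodMk hg')
  map_op e := e.elim
  map_pop p x y hy := by
    have hf' := (mem_lambda₁ _ _ _).1 (hf.map_pop p x y hy)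
    have hg' := (mem_lambda₁ _ _ _).1 (hg.map_pop p x y hy)
    have := h₁ _ _ _ _ hf'.1 hg'.1
    refine (mem_lambda₁ _ _ _).2 ⟨this.1, ?_⟩
    exact this.2.trans (congrArg₂ m hf'.2 hg'.2)
  map_rel r x hx := h₂ _ _ _ _ (hf.map_rel r x hx) (hg.map_rel r x hx)

/-- The morphisms from `X` to `S_os`, as a sublattice of the lattice `S ^ X` with its pointwise
order. -/
def homLattice (X : StructuredSpace sigOs) : Sublattice (X.carrier → S) where
  carrier := homSet X SOs
  supClosed' f hf g hg :=
    isMorphism_pointwise (· ⊔ ·) (by decide) (by decide) X f g hf hg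
  infClosed' f hf g hg :=
    isMorphism_pointwise (· ⊓ ·) (by decide) (by decide) X f g hf hg

/-! ### Hairy cubes -/

/-- The poset `P` is the `n`-dimensional hairy cube with base `Y`; the elements outside `Y` are the
hairs. -/
structure IsHairyCube (n : ℕ) (P : Type*) [PartialOrder P] (Y : Set P) : Prop where
  base_cube : Nonempty (Y ≃o (Fin n → Bool))
  hairs_incomparable : IsAntichain (· ≤ ·) Yᶜ
  base_covered : ∀ y ∈ Y, ∃! x, x ∈ Yᶜ ∧ y ⋖ x
  hair_covers : ∀ x ∈ Yᶜ, ∃! y, y ∈ Y ∧ y ⋖ x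

end HairyCube

/-! The three sets of maps agree by a cycle of inclusions: term functions are morphisms into `SOs`,
these are morphisms into `SStruct`, and these are term functions again. Preserving `r₂` says that
whether `f x` is nonzero is monotone in the support of `x`; preserving `r₃` says that whether `f x =
1` depends only on where `x` is `1`. So `f` is determined by its values at the 0-1 vectors, and it
is the join of the terms `f(A) Φ_A` (`eq_sup_mul_vertexFun`), where `Φ_A` is nonzero iff the support
contains `A`, and is `1` iff the set of ones equals `A`.

A multiple `c Φ_A` lies below a morphism iff `c` is at most its value at the vertex `A`
(`mulVertex_le_iff`). As `S` is a chain, the join-irreducibles are the `h Φ_A` and the `Φ_A`.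
Evaluation at vertices gives their order: the `h Φ_A` form a cube under reverse inclusion, the `Φ_A`
an antichain, and `Φ_A` covers only `h Φ_A` in the base. -/

namespace HairyCube

open StructuredSpace

/-! ### Powers are objects of `IS_cP⁺` -/

/-- If a discrete structure has a one-element substructure `{e}` on which everything is defined and
all relations hold, then its finite powers (also the empty one) lie in `IScP`: adjoin the constant
coordinate `e`. -/
theorem power_mem_IScP {L : Signature} (X : StructuredSpace L) (I : Type) [Finite I]
    [DiscreteTopology X.carrier] (e : X.carrier)
    (hop : ∀ g, X.op g (fun _ => e) = e) (hpop : ∀ p, e ∈ X.pop p (fun _ => e))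
    (hrel : ∀ r, (fun _ => e) ∈ X.rel r) : X.power I ∈ IScP X := by
  let f : (I → X.carrier) → (Option I → X.carrier) := fun x o => o.elim e x
  have hf : Topology.IsClosedEmbedding f := by
    refine .of_continuous_injective_isClosedMap continuous_of_discreteTopology ?_ ?_
    · exact fun x y hxy => funext fun i => congrFun hxy (some i)
    · exact fun s _ => isClosed_discrete _
  refine ⟨Option I, inferInstance, f, ⟨hf, ?_, ?_, ?_⟩⟩
  · intro g x
    funext o
    cases o with
    | none => exact (hop g).symm
    | some i => rfl
  · intro p x
    refine Part.ext' ⟨fun hd i => hd (some i), ?_⟩ ?_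
    · intro hd o
      cases o with
      | none => exact (hpop p).1
      | some i => exact hd i
    · intro h₁ h₂
      funext o
      cases o with
      | none => exact (hpop p).2
      | some i => rfl
  · intro r x
    refine ⟨?_, fun hx i => hx (some i)⟩
    intro hx o
    cases o with
    | none => exact hrel r
    | some i => exact hx i

instance : DiscreteTopology SOs.carrier := inferInstanceAs (DiscreteTopology S)

instance : DiscreteTopology SStruct.carrier := inferInstanceAs (DiscreteTopology S)

theorem SOs_power_mem_IScP (n : ℕ) : SOs.power (Fin n) ∈ IScP SOs :=
  power_mem_IScP SOs (Fin n) (0 : S) (fun g => g.elim)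
    (fun _ => (mem_lambda₁ 0 0 0).2 (by decide))
    (fun _ => show ((0 : S), (0 : S)) ∈ r₂ by decide)

theorem diag_mem (a : S) (r : Fin 3) : (a, a) ∈ (![r₁, r₂, r₃] : Fin 3 → Set (S × S)) r := by
  fin_cases r <;> cases a <;> simp [r₁, r₂, r₃]

theorem SStruct_power_mem_IScP (n : ℕ) : SStruct.power (Fin n) ∈ IScP SStruct :=
  power_mem_IScP SStruct (Fin n) (0 : S) (fun g => g.elim) (fun p => p.elim)
    (fun r => diag_mem 0 r)

/-! ### The inclusions between term functions and the two sets of morphisms -/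

variable {n : ℕ}

theorem mem_r₂ (a b : S) : (a, b) ∈ r₂ ↔ (a ≠ 0 → b ≠ 0) := by
  revert a b; decide

instance : DecidablePred (· ∈ r₃) := fun x =>
  inferInstanceAs (Decidable (¬ (x = (0, 1) ∨ x = (S.h, 1) ∨ x = (1, 0) ∨ x = (1, S.h))))

theorem mem_r₃ (a b : S) : (a, b) ∈ r₃ ↔ (a = 1 ↔ b = 1) := by
  revert a b; decide

theorem isMorphism_const (X : StructuredSpace sigOs) (c : S) :
    IsMorphism X SOs (fun _ => c) where
  continuous := continuous_const
  map_op g := g.elim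
  map_pop _ _ _ _ := (mem_lambda₁ c c c).2 (by revert c; decide)
  map_rel _ _ _ := show (c, c) ∈ r₂ by revert c; decide

theorem isMorphism_eval {I : Type} (X : StructuredSpace sigOs) (i : I) :
    IsMorphism (X.power I) X (fun x : I → X.carrier => x i) where
  continuous := continuous_apply i
  map_op g := g.elim
  map_pop p x y hy := by
    obtain ⟨hd, rfl⟩ := hy
    exact Part.get_mem (hd i)
  map_rel _ _ hx := hx i

theorem termFunctions_subset_homSet (n : ℕ) :
    termFunctions n ⊆ homSet (SOs.power (Fin n)) SOs := by
  rintro f ⟨t, ht⟩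
  obtain rfl : f = fun x => t.eval x := funext ht
  clear ht
  induction t with
  | var i => exact isMorphism_eval SOs i
  | zero => exact isMorphism_const _ 0
  | one => exact isMorphism_const _ 1
  | add s t hs ht =>
    exact isMorphism_pointwise (· + ·) (by decide) (by decide) _ _ _
      hs ht
  | mul s t hs ht =>
    exact isMorphism_pointwise (· * ·) (by decide) (by decide) _ _ _
      hs ht

/-- The operation `λ₁` is preserved, in elementary terms. -/
theorem StructuredSpace.IsMorphism.map_lambda {f : (Fin n → S) → S}
    (hf : IsMorphism (SOs.power (Fin n)) SOs f) {x y : Fin n → S}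
    (hxy : ∀ i, (x i, y i) ∈ r₁) :
    (f x, f y) ∈ r₁ ∧ lambdaVal (f x) (f y) = f (fun i => lambdaVal (x i) (y i)) :=
  (mem_lambda₁ _ _ _).1 (hf.map_pop () ![x, y] (fun i => lambdaVal (x i) (y i)) ⟨hxy, rfl⟩)

/-- Whether a morphism takes the value `1` at `x` depends only on where `x` is `1`. -/
theorem StructuredSpace.IsMorphism.eq_one_of_eq_one {f : (Fin n → S) → S}
    (hf : IsMorphism (SOs.power (Fin n)) SOs f) {x y : Fin n → S}
    (hxy : ∀ i, x i = 1 ↔ y i = 1) (hx : f x = 1) : f y = 1 := by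
  -- On pairs with equal ones, `λ₁` is the second projection, while `λ₁(1, b) = 1` wherever it is
  -- defined. Hence `f y = λ₁(f x, f y) = 1`.
  have key : ∀ a b : S, (a = 1 ↔ b = 1) → (a, b) ∈ r₁ ∧ lambdaVal a b = b := by decide
  have one : ∀ b : S, (1, b) ∈ r₁ → lambdaVal 1 b = 1 := by decide
  obtain ⟨h₁, h₂⟩ := hf.map_lambda fun i => (key _ _ (hxy i)).1
  rw [hx] at h₁ h₂
  rw [one _ h₁, funext fun i => (key _ _ (hxy i)).2] at h₂
  exact h₂.symm

/-- `r₁` is the domain of `λ₁`, `r₂` belongs to both structures, and `r₃` is recovered from `λ₁`. -/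
theorem homSet_SOs_subset_homSet_SStruct (n : ℕ) :
    homSet (SOs.power (Fin n)) SOs ⊆ homSet (SStruct.power (Fin n)) SStruct := by
  intro f hf
  refine ⟨hf.continuous, fun g => g.elim, fun p => p.elim, ?_⟩
  intro (r : Fin 3) x hx
  match r with
  | 0 => exact (IsMorphism.map_lambda hf hx).1
  | 1 => exact hf.map_rel () x hx
  | 2 =>
    have hx' : ∀ i, x (0 : Fin 2) i = (1 : S) ↔ x (1 : Fin 2) i = (1 : S) := fun i => (mem_r₃ _ _).1 (hx i)
    exact (mem_r₃ _ _).2 ⟨IsMorphism.eq_one_of_eq_one hf hx',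
      IsMorphism.eq_one_of_eq_one hf fun i => (hx' i).symm⟩

/-! ### The functions `Φ_A` -/

instance : Nontrivial S := ⟨0, 1, by decide⟩

instance : NoZeroDivisors S := ⟨by decide⟩

/-- The vertex of the cube `{0, 1}ⁿ ⊆ Sⁿ` with indicator `A`. -/
def vertex (A : Fin n → Bool) : Fin n → S := fun i => if A i then 1 else 0

/-- The function `Φ_A = ∏_{i ∈ A} xᵢ ∏_{i ∉ A} (1 + xᵢ)`. -/
def vertexFun (A : Fin n → Bool) (x : Fin n → S) : S := ∏ i, if A i then x i else 1 + x i

/-- A factor `1 + a` never vanishes, so only the indices in `A` matter. In contrast, `1 + a = 1`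
exactly when `a ≠ 1`, so all indices matter for the value `1`. -/
theorem vertexFun_ne_zero_iff (A : Fin n → Bool) (x : Fin n → S) :
    vertexFun A x ≠ 0 ↔ ∀ i, A i → x i ≠ 0 := by
  have key : ∀ (b : Bool) (a : S), (if b then a else 1 + a) ≠ 0 ↔ (b → a ≠ 0) := by decide
  simp only [vertexFun, Finset.prod_ne_zero_iff, key, Finset.mem_univ, true_imp_iff]

theorem vertexFun_eq_one_iff (A : Fin n → Bool) (x : Fin n → S) :
    vertexFun A x = 1 ↔ ∀ i, A i ↔ x i = 1 := by
  have : Subsingleton Sˣ := by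
    have h : ∀ a b : S, a * b = 1 → a = 1 := by decide
    exact ⟨fun u v => Units.ext ((h _ _ u.mul_inv).trans (h _ _ v.mul_inv).symm)⟩
  have key' : ∀ (b : Bool) (a : S), (if b then a else 1 + a) = 1 ↔ (b ↔ a = 1) := by decide
  simp only [vertexFun, Finset.prod_eq_one_iff, key', Finset.mem_univ, true_imp_iff]

theorem vertex_ne_zero_iff (A : Fin n → Bool) (i : Fin n) : vertex A i ≠ 0 ↔ A i := by
  have key : ∀ b : Bool, (if b then (1 : S) else 0) ≠ 0 ↔ b := by decide
  exact key _

theorem vertex_eq_one_iff (A : Fin n → Bool) (i : Fin n) : vertex A i = 1 ↔ A i := by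
  have key : ∀ b : Bool, (if b then (1 : S) else 0) = 1 ↔ b := by decide
  exact key _

theorem vertexFun_vertex (A : Fin n → Bool) : vertexFun A (vertex A) = 1 :=
  (vertexFun_eq_one_iff _ _).2 fun i => (vertex_eq_one_iff A i).symm

theorem map_support_SStruct {f : (Fin n → S) → S}
    (hf : IsMorphism (SStruct.power (Fin n)) SStruct f) {x y : Fin n → S}
    (hxy : ∀ i, x i ≠ 0 → y i ≠ 0) : f x ≠ 0 → f y ≠ 0 :=
  (mem_r₂ _ _).1 (hf.map_rel (1 : Fin 3) ![x, y] fun i => (mem_r₂ _ _).2 (hxy i))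

theorem map_ones_SStruct {f : (Fin n → S) → S}
    (hf : IsMorphism (SStruct.power (Fin n)) SStruct f) {x y : Fin n → S}
    (hxy : ∀ i, x i = 1 ↔ y i = 1) : f x = 1 ↔ f y = 1 :=
  (mem_r₃ _ _).1 (hf.map_rel (2 : Fin 3) ![x, y] fun i => (mem_r₃ _ _).2 (hxy i))

/-- The multiple `c Φ_A` lies below the morphism `f` as soon as `c ≤ f A`. -/
theorem mul_vertexFun_le {f : (Fin n → S) → S}
    (hf : IsMorphism (SStruct.power (Fin n)) SStruct f) (A : Fin n → Bool) {c : S}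
    (hc : c ≤ f (vertex A)) (x : Fin n → S) : c * vertexFun A x ≤ f x := by
  have key : ∀ c a m y : S, c ≤ a → (m ≠ 0 → a ≠ 0 → y ≠ 0) → (m = 1 → (a = 1 ↔ y = 1)) →
      c * m ≤ y := by decide
  refine key _ _ _ _ hc (fun hm => ?_) fun hm => ?_
  · refine map_support_SStruct hf fun i hi => ?_
    exact (vertexFun_ne_zero_iff A x).1 hm i ((vertex_ne_zero_iff A i).1 hi)
  · refine map_ones_SStruct hf fun i => ?_
    exact (vertex_eq_one_iff A i).trans ((vertexFun_eq_one_iff A x).1 hm i)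

/-- At each point, a morphism is attained by one of the functions `f(A) Φ_A`. -/
theorem exists_le_mul_vertexFun {f : (Fin n → S) → S}
    (hf : IsMorphism (SStruct.power (Fin n)) SStruct f) (x : Fin n → S) :
    ∃ A, f x ≤ f (vertex A) * vertexFun A x := by
  -- The witness is the set of ones of `x` if `f x = 1`, and otherwise the support of `x`, where a
  -- nonzero product already suffices.
  by_cases h1 : f x = 1
  · refine ⟨fun i => decide (x i = 1), ?_⟩
    rw [h1, (map_ones_SStruct hf fun i => by simp [vertex_eq_one_iff]).1 h1,
      (vertexFun_eq_one_iff _ _).2 fun i => by simp]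
    decide
  · have key : ∀ y a m : S, y ≠ 1 → (y ≠ 0 → a ≠ 0) → m ≠ 0 → y ≤ a * m := by decide
    refine ⟨fun i => decide (x i ≠ 0), key _ _ _ h1 ?_ ?_⟩
    · exact map_support_SStruct hf fun i hi => by simpa [vertex_ne_zero_iff] using hi
    · exact (vertexFun_ne_zero_iff _ _).2 fun i hi => by simpa using hi

/-! ### Morphisms are term functions -/

theorem const_mem_termFunctions (c : S) : (fun _ => c) ∈ termFunctions n :=
  match c with
  | .zero => ⟨.zero, fun _ => rfl⟩
  | .h => ⟨.add .one .one, fun _ => rfl⟩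
  | .one => ⟨.one, fun _ => rfl⟩

theorem add_mem_termFunctions {f g : (Fin n → S) → S} (hf : f ∈ termFunctions n)
    (hg : g ∈ termFunctions n) : (fun x => f x + g x) ∈ termFunctions n := by
  obtain ⟨s, hs⟩ := hf
  obtain ⟨t, ht⟩ := hg
  exact ⟨.add s t, fun x => congrArg₂ _ (hs x) (ht x)⟩

theorem mul_mem_termFunctions {f g : (Fin n → S) → S} (hf : f ∈ termFunctions n)
    (hg : g ∈ termFunctions n) : (fun x => f x * g x) ∈ termFunctions n := by
  obtain ⟨s, hs⟩ := hf
  obtain ⟨t, ht⟩ := hg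
  exact ⟨.mul s t, fun x => congrArg₂ _ (hs x) (ht x)⟩

theorem vertexFun_mem_termFunctions (A : Fin n → Bool) : vertexFun A ∈ termFunctions n := by
  suffices h : ∀ s : Finset (Fin n),
      (fun x => ∏ i ∈ s, if A i then x i else 1 + x i) ∈ termFunctions n from h Finset.univ
  intro s
  induction s using Finset.induction_on with
  | empty => simpa using const_mem_termFunctions 1
  | insert i s hi ih =>
    have hvar : (fun x => x i) ∈ termFunctions n := ⟨.var i, fun _ => rfl⟩
    simp only [Finset.prod_insert hi]
    refine mul_mem_termFunctions ?_ ih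
    cases A i with
    | true => simpa using hvar
    | false => simpa using add_mem_termFunctions (const_mem_termFunctions 1) hvar

theorem mul_vertexFun_mem_termFunctions (A : Fin n → Bool) (c : S) :
    (fun x => c * vertexFun A x) ∈ termFunctions n :=
  mul_mem_termFunctions (const_mem_termFunctions c) (vertexFun_mem_termFunctions A)

instance : OrderBot S where
  bot := 0
  bot_le := by decide

theorem finset_sup_mem_termFunctions {ι : Type*} (s : Finset ι) (f : ι → (Fin n → S) → S)
    (hf : ∀ i, f i ∈ termFunctions n) : (fun x => s.sup fun i => f i x) ∈ termFunctions n := by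
  classical
  induction s using Finset.induction_on with
  | empty => simpa using const_mem_termFunctions (⊥ : S)
  | insert i s hi ih =>
    simp only [Finset.sup_insert]
    -- The join is the polynomial `x + y + x * y`.
    exact add_mem_termFunctions (add_mem_termFunctions (hf i) ih) (mul_mem_termFunctions (hf i) ih)

/-- Every morphism is the join of the functions `f(A) Φ_A`. -/
theorem eq_sup_mul_vertexFun {f : (Fin n → S) → S}
    (hf : IsMorphism (SStruct.power (Fin n)) SStruct f) (x : Fin n → S) :
    f x = Finset.univ.sup fun A => f (vertex A) * vertexFun A x := by
  refine le_antisymm ?_ (Finset.sup_le fun A _ => mul_vertexFun_le hf A le_rfl x)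
  obtain ⟨A, hA⟩ := exists_le_mul_vertexFun hf x
  exact hA.trans (Finset.le_sup (f := fun A => f (vertex A) * vertexFun A x) (Finset.mem_univ A))

theorem homSet_SStruct_subset_termFunctions (n : ℕ) :
    homSet (SStruct.power (Fin n)) SStruct ⊆ termFunctions n := by
  intro (f : (Fin n → S) → S) hf
  have h := finset_sup_mem_termFunctions Finset.univ (fun A x => f (vertex A) * vertexFun A x)
    fun A => mul_vertexFun_mem_termFunctions A (f (vertex A))
  rwa [← show f = _ from funext (eq_sup_mul_vertexFun hf)] at h

theorem homSet_SOs_eq_homSet_SStruct (n : ℕ) :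
    homSet (SOs.power (Fin n)) SOs = homSet (SStruct.power (Fin n)) SStruct :=
  (homSet_SOs_subset_homSet_SStruct n).antisymm
    ((homSet_SStruct_subset_termFunctions n).trans (termFunctions_subset_homSet n))

theorem homSet_SOs_eq_termFunctions (n : ℕ) :
    homSet (SOs.power (Fin n)) SOs = termFunctions n :=
  ((homSet_SOs_subset_homSet_SStruct n).trans (homSet_SStruct_subset_termFunctions n)).antisymm
    (termFunctions_subset_homSet n)

/-! ### Join-irreducible morphisms -/

/-- The morphism `c Φ_A`. -/
def mulVertex (A : Fin n → Bool) (c : S) : homLattice (SOs.power (Fin n)) :=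
  ⟨fun x => c * vertexFun A x,
    termFunctions_subset_homSet n (mul_vertexFun_mem_termFunctions A c)⟩

/-- The value of a morphism at a vertex of the cube. -/
def valueAt (Φ : homLattice (SOs.power (Fin n))) (A : Fin n → Bool) : S :=
  (Φ.1 : (Fin n → S) → S) (vertex A)

theorem mulVertex_le_iff (A : Fin n → Bool) (c : S) (Φ : homLattice (SOs.power (Fin n))) :
    mulVertex A c ≤ Φ ↔ c ≤ valueAt Φ A := by
  constructor
  · intro h
    have h' : c * vertexFun A (vertex A) ≤ valueAt Φ A := h (vertex A)
    rwa [vertexFun_vertex, mul_one] at h'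
  · exact fun h => mul_vertexFun_le (homSet_SOs_subset_homSet_SStruct n Φ.2) A h

theorem valueAt_mulVertex_self (A : Fin n → Bool) (c : S) : valueAt (mulVertex A c) A = c := by
  change c * vertexFun A (vertex A) = c
  rw [vertexFun_vertex, mul_one]

/-- Evaluation at the vertex `A` turns a join into a maximum in a chain, so one of the two joinands
already has value `c` there. -/
theorem supIrred_mulVertex (A : Fin n → Bool) {c : S} (hc : c ≠ 0) :
    SupIrred (mulVertex A c) := by
  constructor
  · intro hmin
    have h := (mulVertex_le_iff A c _).1 (hmin ((mulVertex_le_iff A 0 _).2 bot_le))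
    rw [valueAt_mulVertex_self] at h
    exact hc (le_bot_iff.1 h)
  · intro Φ Ψ h
    have key : ∀ a b c : S, c = a ⊔ b → c ≤ a ∨ c ≤ b := by decide
    have hsup : c = valueAt Φ A ⊔ valueAt Ψ A := by
      rw [← valueAt_mulVertex_self A c, ← h]; rfl
    refine (key _ _ _ hsup).imp (fun h' => ?_) fun h' => ?_
    · exact le_antisymm (h ▸ le_sup_left) ((mulVertex_le_iff A c Φ).2 h')
    · exact le_antisymm (h ▸ le_sup_right) ((mulVertex_le_iff A c Ψ).2 h')

/-- Irreducibility selects one member of the finite join of the `Φ(A) Φ_A`; its coefficient is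
nonzero because `Φ` is not minimal. -/
theorem exists_eq_mulVertex {Φ : homLattice (SOs.power (Fin n))} (hΦ : SupIrred Φ) :
    ∃ A c, c ≠ 0 ∧ mulVertex A c = Φ := by
  let _ : OrderBot (homLattice (SOs.power (Fin n))) :=
    { bot := ⟨fun _ => (0 : S), isMorphism_const _ 0⟩
      bot_le := fun Ψ x => show (0 : S) ≤ _ from bot_le }
  have hsup : Finset.univ.sup (fun A => mulVertex A (valueAt Φ A)) = Φ := by
    refine le_antisymm (Finset.sup_le fun A _ => (mulVertex_le_iff A _ Φ).2 le_rfl) fun x => ?_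
    obtain ⟨A, hA⟩ := exists_le_mul_vertexFun (homSet_SOs_subset_homSet_SStruct n Φ.2) x
    exact le_trans hA (Finset.le_sup (f := fun A => mulVertex A (valueAt Φ A))
      (Finset.mem_univ A) x)
  obtain ⟨A, -, hA⟩ := hΦ.finset_sup_eq hsup
  refine ⟨A, valueAt Φ A, fun h0 => hΦ.1 ?_, hA⟩
  intro Ψ _
  rw [← hA]
  exact (mulVertex_le_iff A _ Ψ).2 (h0 ▸ bot_le)

theorem mulVertex_h_le_mulVertex_iff (A B : Fin n → Bool) {c : S} (hc : c ≠ 0) :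
    mulVertex A S.h ≤ mulVertex B c ↔ B ≤ A := by
  have key : ∀ c m : S, c ≠ 0 → (S.h ≤ c * m ↔ m ≠ 0) := by decide
  rw [mulVertex_le_iff]
  refine (key _ _ hc).trans ((vertexFun_ne_zero_iff _ _).trans ?_)
  simp only [vertex_ne_zero_iff]
  exact Iff.rfl

theorem mulVertex_one_le_mulVertex_one_iff (A B : Fin n → Bool) :
    mulVertex A 1 ≤ mulVertex B 1 ↔ A = B := by
  have key : ∀ m : S, (1 ≤ 1 * m ↔ m = 1) := by decide
  rw [mulVertex_le_iff]
  refine (key _).trans ((vertexFun_eq_one_iff _ _).trans ?_)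
  simp only [vertex_eq_one_iff]
  exact ⟨fun h => funext fun i => Bool.eq_iff_iff.2 (h i).symm, fun h i => by rw [h]⟩

theorem not_mulVertex_one_le_mulVertex_h (A B : Fin n → Bool) :
    ¬ mulVertex A 1 ≤ mulVertex B S.h := by
  have key : ∀ m : S, ¬ 1 ≤ S.h * m := by decide
  rw [mulVertex_le_iff]
  exact key _

/-- The poset of join-irreducible morphisms. -/
abbrev Irr (n : ℕ) : Type := {Φ : homLattice (SOs.power (Fin n)) // SupIrred Φ}

/-- The base of the poset of join-irreducible morphisms. -/
abbrev irrBase (n : ℕ) : Set (Irr n) :=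
  {Φ | ∀ x, (Φ.1 : (SOs.power (Fin n)).carrier → S) x ≤ S.h}

/-- The base element `h Φ_A`. -/
def baseElt (A : Fin n → Bool) : Irr n := ⟨mulVertex A S.h, supIrred_mulVertex A (by decide)⟩

/-- The hair `Φ_A`. -/
def hairElt (A : Fin n → Bool) : Irr n := ⟨mulVertex A 1, supIrred_mulVertex A (by decide)⟩

theorem baseElt_le_baseElt_iff (A B : Fin n → Bool) : baseElt A ≤ baseElt B ↔ B ≤ A :=
  mulVertex_h_le_mulVertex_iff A B (by decide)

theorem baseElt_le_hairElt_iff (A B : Fin n → Bool) : baseElt A ≤ hairElt B ↔ B ≤ A :=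
  mulVertex_h_le_mulVertex_iff A B (by decide)

theorem hairElt_le_hairElt_iff (A B : Fin n → Bool) : hairElt A ≤ hairElt B ↔ A = B :=
  mulVertex_one_le_mulVertex_one_iff A B

theorem not_hairElt_le_baseElt (A B : Fin n → Bool) : ¬ hairElt A ≤ baseElt B :=
  not_mulVertex_one_le_mulVertex_h A B

theorem baseElt_mem (A : Fin n → Bool) : baseElt A ∈ irrBase n := by
  have key : ∀ m : S, S.h * m ≤ S.h := by decide
  exact fun x => key _

theorem hairElt_notMem (A : Fin n → Bool) : hairElt A ∉ irrBase n := by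
  intro h
  have h' : valueAt (mulVertex A 1) A ≤ S.h := h (vertex A)
  rw [valueAt_mulVertex_self] at h'
  exact absurd h' (by decide)

theorem baseElt_or_hairElt (Φ : Irr n) : (∃ A, Φ = baseElt A) ∨ ∃ A, Φ = hairElt A := by
  obtain ⟨Φ, hΦ⟩ := Φ
  obtain ⟨A, c, hc, rfl⟩ := exists_eq_mulVertex hΦ
  cases c with
  | zero => exact absurd rfl hc
  | h => exact .inl ⟨A, rfl⟩
  | one => exact .inr ⟨A, rfl⟩

theorem mem_irrBase_iff (Φ : Irr n) : Φ ∈ irrBase n ↔ ∃ A, baseElt A = Φ := by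
  constructor
  · intro h
    rcases baseElt_or_hairElt Φ with ⟨A, rfl⟩ | ⟨A, rfl⟩
    · exact ⟨A, rfl⟩
    · exact absurd h (hairElt_notMem A)
  · rintro ⟨A, rfl⟩
    exact baseElt_mem A

theorem mem_irrBase_compl_iff (Φ : Irr n) : Φ ∈ (irrBase n)ᶜ ↔ ∃ A, hairElt A = Φ := by
  constructor
  · intro h
    rcases baseElt_or_hairElt Φ with ⟨A, rfl⟩ | ⟨A, rfl⟩
    · exact absurd (baseElt_mem A) h
    · exact ⟨A, rfl⟩
  · rintro ⟨A, rfl⟩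
    exact hairElt_notMem A

/-- Among the base elements below `Φ_B`, the largest is `h Φ_B`; for `A ≠ B` it lies strictly
between `h Φ_A` and `Φ_B`. -/
theorem baseElt_covBy_hairElt_iff (A B : Fin n → Bool) : baseElt A ⋖ hairElt B ↔ A = B := by
  have hlt : ∀ C : Fin n → Bool, baseElt C < hairElt C := fun C =>
    lt_of_le_not_ge ((baseElt_le_hairElt_iff C C).2 le_rfl) (not_hairElt_le_baseElt C C)
  constructor
  · intro h
    have hBA : B ≤ A := (baseElt_le_hairElt_iff A B).1 h.le
    have hle : baseElt A ≤ baseElt B := (baseElt_le_baseElt_iff A B).2 hBA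
    by_contra hne
    refine h.2 (lt_of_le_of_ne hle fun he => hne ?_) (hlt B)
    exact le_antisymm ((baseElt_le_baseElt_iff B A).1 he.ge) hBA
  · rintro rfl
    refine ⟨hlt A, fun Φ h₁ h₂ => ?_⟩
    rcases baseElt_or_hairElt Φ with ⟨C, rfl⟩ | ⟨C, rfl⟩
    · have hCA := (baseElt_le_hairElt_iff C A).1 h₂.le
      exact h₁.not_ge ((baseElt_le_baseElt_iff C A).2 hCA)
    · obtain rfl := (hairElt_le_hairElt_iff C A).1 h₂.le
      exact lt_irrefl _ h₂

/-- The base is (anti-)isomorphic to the cube, via `A ↦ h Φ_{Aᶜ}`. -/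
theorem nonempty_irrBase_orderIso (n : ℕ) : Nonempty (irrBase n ≃o (Fin n → Bool)) := by
  let e : (Fin n → Bool) ↪o irrBase n :=
    OrderEmbedding.ofMapLEIff (fun A => ⟨baseElt Aᶜ, baseElt_mem _⟩) fun A B =>
      (baseElt_le_baseElt_iff _ _).trans compl_le_compl_iff_le
  refine ⟨(RelIso.ofSurjective e ?_).symm⟩
  rintro ⟨Φ, hΦ⟩
  obtain ⟨A, rfl⟩ := (mem_irrBase_iff Φ).1 hΦ
  exact ⟨Aᶜ, Subtype.ext (congrArg baseElt (compl_compl A))⟩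

theorem isHairyCube_irr (n : ℕ) : IsHairyCube n (Irr n) (irrBase n) where
  base_cube := nonempty_irrBase_orderIso n
  hairs_incomparable := by
    intro Φ hΦ Ψ hΨ hne hle
    obtain ⟨A, rfl⟩ := (mem_irrBase_compl_iff Φ).1 hΦ
    obtain ⟨B, rfl⟩ := (mem_irrBase_compl_iff Ψ).1 hΨ
    exact hne (congrArg hairElt ((hairElt_le_hairElt_iff A B).1 hle))
  base_covered := by
    intro Φ hΦ
    obtain ⟨A, rfl⟩ := (mem_irrBase_iff Φ).1 hΦ
    refine ⟨hairElt A, ⟨hairElt_notMem A, (baseElt_covBy_hairElt_iff A A).2 rfl⟩, ?_⟩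
    rintro Ψ ⟨hΨ, hcov⟩
    obtain ⟨B, rfl⟩ := (mem_irrBase_compl_iff Ψ).1 hΨ
    exact congrArg hairElt ((baseElt_covBy_hairElt_iff A B).1 hcov).symm
  hair_covers := by
    intro Φ hΦ
    obtain ⟨A, rfl⟩ := (mem_irrBase_compl_iff Φ).1 hΦ
    refine ⟨baseElt A, ⟨baseElt_mem A, (baseElt_covBy_hairElt_iff A A).2 rfl⟩, ?_⟩
    rintro Ψ ⟨hΨ, hcov⟩
    obtain ⟨B, rfl⟩ := (mem_irrBase_iff Ψ).1 hΨ
    exact congrArg baseElt ((baseElt_covBy_hairElt_iff B A).1 hcov)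

end HairyCube

open HairyCube HairyCube.StructuredSpace in
theorem corollary4p9 (n : ℕ) :
    (SOs.power (Fin n) ∈ IScP SOs ∧ SStruct.power (Fin n) ∈ IScP SStruct) ∧
    homSet (SOs.power (Fin n)) SOs = homSet (SStruct.power (Fin n)) SStruct ∧
    homSet (SOs.power (Fin n)) SOs = termFunctions n ∧
    IsHairyCube n {Φ : homLattice (SOs.power (Fin n)) // SupIrred Φ}
      {Φ | ∀ x, (Φ.1 : (SOs.power (Fin n)).carrier → S) x ≤ S.h} :=
  ⟨⟨SOs_power_mem_IScP n, SStruct_power_mem_IScP n⟩, homSet_SOs_eq_homSet_SStruct n,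
    homSet_SOs_eq_termFunctions n, isHairyCube_irr n⟩
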